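/- Let $X$ be a Cantor set (a non-empty compact metrizable totally disconnected space without isolated points), let $n \geq 3$ be odd, and let $\alpha : X \to X$ and $\beta : S^n \to S^n$ be homeomorphisms such that the product homeomorphism $\alpha \times \beta : X \times S^n \to X \times S^n$, $(x,s) \mapsto (\alpha(x), \beta(s))$, is minimal (every orbit $\{(\alpha\times\beta)^k(z) : k \in \mathbb{Z}\}$ is dense). Let $A = C(X \times S^n) \rtimes_{\alpha \times \beta} \mathbb{Z}$ be the crossed product, with canonical unitary $u$, so that $u f u^* = f \circ (\alpha \times \beta)^{-1}$ for all $f \in C(X \times S^n)$. For $y \in X$ let $$A_{\{y\}} = \mathrm{C}^*\bigl(C(X \times S^n),\; u\, C_0((X \setminus \{y\}) \times S^n)\bigr) \subseteq A$$ be the $\mathrm{C}^*$-subalgebra generated by $C(X \times S^n)$ and all $u f$ with $f \in C(X \times S^n)$ vanishing on $\{y\} \times S^n$. Then for every $y \in X$ the $\mathrm{C}^*$-algebra $A_{\{y\}}$ is simple, that is, it is non-zero and has no closed two-sided ideals other than $0$ and $A_{\{y\}}$. -/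

import Mathlib

open scoped ENNReal

universe u

noncomputable section

namespace OrbitBreaking

/-- A homeomorphism of a topological space is minimal if every orbit `{h ^ k z | k ∈ ℤ}` is
dense. -/
def IsMinimalHomeo {Z : Type u} [TopologicalSpace Z] (h : Z ≃ₜ Z) : Prop :=
  ∀ z : Z, Dense (Set.range fun k : ℤ => (h ^ k) z)

/-- A C⋆-algebra is simple if it is nonzero and its only closed two-sided ideals are `0` and the
whole algebra. -/
def IsSimpleCStar (A : Type*) [CStarAlgebra A] : Prop :=
  Nontrivial A ∧ ∀ I : TwoSidedIdeal A, IsClosed (I : Set A) → I = ⊥ ∨ I = ⊤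

section CrossedProduct

variable {Z : Type u} [TopologicalSpace Z] [CompactSpace Z]

/-- A (unital) covariant pair for the action of `ℤ` on `C(Z)` generated by `f ↦ f ∘ h⁻¹`: a nonzero
unital C⋆-algebra `B`, a unital ⋆-homomorphism `π : C(Z) → B` and a unitary `U ∈ B` with
`U π(f) U⋆ = π(f ∘ h⁻¹)` for all `f`. -/
structure CovariantPair (h : Z ≃ₜ Z) : Type (u + 1) where
  B : Type u
  [cstar : CStarAlgebra B]
  [nontrivial : Nontrivial B]
  π : C(Z, ℂ) →⋆ₐ[ℂ] B
  U : unitary B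
  covariant : ∀ f : C(Z, ℂ),
    (U : B) * π f * star (U : B) = π (f.comp (h.symm : C(Z, Z)))

attribute [instance] CovariantPair.cstar CovariantPair.nontrivial

/-- The C⋆-algebra of all bounded families indexed by the covariant pairs, with the supremum
norm and pointwise operations. -/
abbrev PairProduct (h : Z ≃ₜ Z) : Type (u + 1) :=
  lp (fun P : CovariantPair h => P.B) ∞

instance (h : Z ≃ₜ Z) : CStarAlgebra (PairProduct h) where

/-- The image of `f ∈ C(Z)` in all covariant pairs simultaneously. -/
def pairFun (h : Z ≃ₜ Z) (f : C(Z, ℂ)) : PairProduct h :=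
  ⟨fun P => P.π f, memℓp_infty ⟨‖f‖, by
    rintro _ ⟨P, rfl⟩
    exact NonUnitalStarAlgHom.norm_apply_le P.π f⟩⟩

/-- The unitaries of all covariant pairs simultaneously. -/
def pairUnitary (h : Z ≃ₜ Z) : PairProduct h :=
  ⟨fun P => (P.U : P.B), memℓp_infty ⟨1, by
    rintro _ ⟨P, rfl⟩
    exact (CStarRing.norm_coe_unitary P.U).le⟩⟩

/-- The (full) crossed product `C(Z) ⋊_h ℤ`, as the C⋆-algebra generated by `C(Z)` and the
canonical unitary in the product of all covariant pairs. On the ⋆-algebra generated by these, the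
norm is the supremum of the norms in all covariant pairs, which is the norm of the full
crossed product. -/
def crossedProductIn (h : Z ≃ₜ Z) : StarSubalgebra ℂ (PairProduct h) :=
  (StarAlgebra.adjoin ℂ
    (Set.range (pairFun h) ∪ {pairUnitary h})).topologicalClosure

/-- The crossed product `C(Z) ⋊_h ℤ` as a type. -/
abbrev CrossedProduct (h : Z ≃ₜ Z) : Type (u + 1) := ↥(crossedProductIn h)

instance (h : Z ≃ₜ Z) : CStarAlgebra (CrossedProduct h) :=
  StarSubalgebra.cstarAlgebra (crossedProductIn h)
    (h_closed := StarSubalgebra.isClosed_topologicalClosure _)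

/-- The canonical map `C(Z) → C(Z) ⋊_h ℤ`. -/
def ofFun (h : Z ≃ₜ Z) (f : C(Z, ℂ)) : CrossedProduct h :=
  ⟨pairFun h f, StarSubalgebra.le_topologicalClosure _
    (StarAlgebra.subset_adjoin ℂ _ (Or.inl ⟨f, rfl⟩))⟩

/-- The canonical unitary `u ∈ C(Z) ⋊_h ℤ`. -/
def canonicalUnitary (h : Z ≃ₜ Z) : CrossedProduct h :=
  ⟨pairUnitary h, StarSubalgebra.le_topologicalClosure _
    (StarAlgebra.subset_adjoin ℂ _ (Or.inr rfl))⟩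

end CrossedProduct

section FibreBreaking

variable {X : Type u} {S : Type} [TopologicalSpace X] [CompactSpace X]
  [TopologicalSpace S] [CompactSpace S]

/-- For a homeomorphism `h` of `X × S` and a closed set `Y ⊆ X`, the orbit-breaking subalgebra
`A_Y = C⋆(C(X × S), u C₀((X ∖ Y) × S))` of `C(X × S) ⋊_h ℤ`. Here `C₀((X ∖ Y) × S)` is the set of
continuous functions on `X × S` that vanish on `Y × S`. -/
def orbitBreaking (h : X × S ≃ₜ X × S) (Y : Set X) : StarSubalgebra ℂ (CrossedProduct h) :=
  (StarAlgebra.adjoin ℂ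
    (Set.range (ofFun h) ∪
      {a | ∃ f : C(X × S, ℂ), (∀ p : X × S, p.1 ∈ Y → f p = 0) ∧
        a = canonicalUnitary h * ofFun h f})).topologicalClosure

instance (h : X × S ≃ₜ X × S) (Y : Set X) : CStarAlgebra (orbitBreaking h Y) :=
  StarSubalgebra.cstarAlgebra (orbitBreaking h Y)
    (h_closed := StarSubalgebra.isClosed_topologicalClosure _)

end FibreBreaking

end OrbitBreaking

end

set_option linter.unusedSectionVars false

noncomputable section

namespace OrbitBreaking

open Filter Topology

/-- Convergence of a bounded family of operators to a limit in a closed subspace passes from a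
set to the closure of its span. -/
theorem exists_tendsto_of_mem_closure_span {ι V : Type*} [NormedAddCommGroup V] [NormedSpace ℂ V]
    [CompleteSpace V] {l : Filter ι} [l.NeBot] (T : ι → V →ₗ[ℂ] V) (C : ℝ)
    (hT : ∀ i x, ‖T i x‖ ≤ C * ‖x‖) (R : Submodule ℂ V) (hR : IsClosed (R : Set V)) (s : Set V)
    (hs : ∀ x ∈ s, ∃ y ∈ R, Tendsto (fun i => T i x) l (𝓝 y)) {x : V}
    (hx : x ∈ closure (Submodule.span ℂ s : Set V)) :
    ∃ y ∈ R, Tendsto (fun i => T i x) l (𝓝 y) := by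
  have hspan : ∀ x ∈ Submodule.span ℂ s, ∃ y ∈ R, Tendsto (fun i => T i x) l (𝓝 y) := by
    intro x hx
    induction hx using Submodule.span_induction with
    | mem x hx => exact hs x hx
    | zero => exact ⟨0, R.zero_mem, by simp⟩
    | add a b _ _ ha hb =>
      obtain ⟨y, hy, hy'⟩ := ha
      obtain ⟨z, hz, hz'⟩ := hb
      exact ⟨y + z, R.add_mem hy hz, by simpa using hy'.add hz'⟩
    | smul c a _ ha =>
      obtain ⟨y, hy, hy'⟩ := ha
      exact ⟨c • y, R.smul_mem c hy, by simpa using hy'.const_smul c⟩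
  have key : ∀ ε > 0, ∃ y ∈ R, ∀ᶠ i in l, dist (T i x) y < ε := by
    intro ε hε
    have hC : 0 < |C| + 1 := by positivity
    obtain ⟨x', hx', hd⟩ := Metric.mem_closure_iff.1 hx (ε / 2 / (|C| + 1)) (by positivity)
    obtain ⟨y, hy, hy'⟩ := hspan x' hx'
    refine ⟨y, hy, ?_⟩
    filter_upwards [Metric.tendsto_nhds.1 hy' (ε / 2) (by positivity)] with i hi
    have h1 : dist (T i x) (T i x') ≤ ε / 2 := by
      rw [dist_eq_norm, ← map_sub]
      calc ‖T i (x - x')‖ ≤ C * ‖x - x'‖ := hT i _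
        _ ≤ (|C| + 1) * (ε / 2 / (|C| + 1)) := by
          rw [dist_eq_norm] at hd
          have := le_abs_self C
          gcongr
          linarith
        _ = ε / 2 := by field_simp
    calc dist (T i x) y ≤ dist (T i x) (T i x') + dist (T i x') y := dist_triangle _ _ _
      _ < ε := by linarith
  have hc : Cauchy (map (fun i => T i x) l) := by
    refine Metric.cauchy_iff.2 ⟨inferInstance, fun ε hε => ?_⟩
    obtain ⟨y, -, hy⟩ := key (ε / 2) (by positivity)
    refine ⟨Metric.ball y (ε / 2), hy, fun a ha b hb => ?_⟩
    have := dist_triangle_right a b y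
    rw [Metric.mem_ball] at ha hb
    linarith
  obtain ⟨y, hy⟩ := cauchy_map_iff_exists_tendsto.1 hc
  refine ⟨y, ?_, hy⟩
  refine Metric.mem_of_closed' hR |>.2 fun ε hε => ?_
  obtain ⟨b, hb, hb'⟩ := key (ε / 2) (by positivity)
  refine ⟨b, hb, ?_⟩
  have : dist y b ≤ ε / 2 :=
    le_of_tendsto (hy.dist tendsto_const_nhds) (hb'.mono fun i hi => hi.le)
  linarith

theorem norm_sum_le_norm_sum_of_subset {A ι : Type*} [CStarAlgebra A] {s t : Finset ι}
    (hst : s ⊆ t) (x : ι → A) : ‖∑ i ∈ s, star (x i) * x i‖ ≤ ‖∑ i ∈ t, star (x i) * x i‖ := by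
  let := CStarAlgebra.spectralOrder A
  have := CStarAlgebra.spectralOrderedRing A
  exact CStarAlgebra.norm_le_norm_of_nonneg_of_le
    (Finset.sum_nonneg fun i _ => star_mul_self_nonneg _)
    (Finset.sum_le_sum_of_subset_of_nonneg hst fun i _ _ => star_mul_self_nonneg _)

/-- The average of finitely many linear maps. -/
def average {V : Type*} [AddCommGroup V] [Module ℂ V] (M : ℕ) (T : ℕ → V →ₗ[ℂ] V) : V →ₗ[ℂ] V :=
  (M : ℂ)⁻¹ • ∑ j ∈ Finset.range M, T j

theorem average_apply {V : Type*} [AddCommGroup V] [Module ℂ V] (M : ℕ) (T : ℕ → V →ₗ[ℂ] V)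
    (x : V) : average M T x = (M : ℂ)⁻¹ • ∑ j ∈ Finset.range M, T j x := by
  simp [average]

theorem norm_average_le {V : Type*} [NormedAddCommGroup V] [NormedSpace ℂ V] (M : ℕ)
    (T : ℕ → V →ₗ[ℂ] V) (hT : ∀ j x, ‖T j x‖ ≤ ‖x‖) (x : V) : ‖average M T x‖ ≤ ‖x‖ := by
  rw [average_apply, norm_smul, norm_inv, Complex.norm_natCast]
  have : ‖∑ j ∈ Finset.range M, T j x‖ ≤ M * ‖x‖ := by
    refine (norm_sum_le_of_le _ fun j _ => hT j x).trans ?_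
    simp
  rcases Nat.eq_zero_or_pos M with rfl | hM
  · simp
  · rw [inv_mul_le_iff₀ (by positivity)]
    exact this

theorem sum_range_pow_eq_zero {ζ : ℂ} {M : ℕ} (h1 : ζ ≠ 1) (hM : ζ ^ M = 1) :
    ∑ j ∈ Finset.range M, ζ ^ j = 0 := by
  rw [geom_sum_eq h1, hM]
  simp

/-- A nonempty closed set that is forward invariant under a minimal homeomorphism is everything. -/
theorem IsMinimalHomeo.eq_univ_of_forward {Z : Type u} [TopologicalSpace Z] [CompactSpace Z]
    {h : Z ≃ₜ Z} (hm : IsMinimalHomeo h) {G : Set Z} (hG : IsClosed G) (hne : G.Nonempty)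
    (hinv : ∀ z ∈ G, h z ∈ G) : G = Set.univ := by
  have hpow : ∀ (n : ℕ) z, z ∈ G → (h ^ n) z ∈ G := by
    intro n
    induction n with
    | zero => intro z hz; simpa using hz
    | succ n ih =>
      intro z hz
      rw [pow_succ']
      exact hinv _ (ih z hz)
  let t : ℕ → Set Z := fun n => ((h ^ n : Z ≃ₜ Z)⁻¹ : Z ≃ₜ Z) ⁻¹' G
  have ht : (⋂ n, t n).Nonempty := by
    refine IsCompact.nonempty_iInter_of_sequence_nonempty_isCompact_isClosed t ?_ ?_ ?_ ?_
    · intro n z hz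
      have : ((h ^ n)⁻¹ : Z ≃ₜ Z) z = h (((h ^ (n + 1))⁻¹ : Z ≃ₜ Z) z) := by
        rw [← Homeomorph.mul_apply]
        congr 1
        group
      show ((h ^ n)⁻¹ : Z ≃ₜ Z) z ∈ G
      rw [this]
      exact hinv _ hz
    · intro n
      obtain ⟨z, hz⟩ := hne
      refine ⟨(h ^ n) z, ?_⟩
      show ((h ^ n)⁻¹ : Z ≃ₜ Z) ((h ^ n) z) ∈ G
      rw [← Homeomorph.mul_apply, inv_mul_cancel]
      exact hz
    · exact (hG.preimage (Homeomorph.continuous _)).isCompact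
    · intro n
      exact hG.preimage (Homeomorph.continuous _)
  obtain ⟨w, hw⟩ := ht
  rw [Set.mem_iInter] at hw
  have hsub : Set.range (fun k : ℤ => (h ^ k) w) ⊆ G := by
    rintro _ ⟨k, rfl⟩
    obtain ⟨n, rfl | rfl⟩ := k.eq_nat_or_neg
    · have := hpow n w (by simpa [t] using hw 0)
      simpa using this
    · have := hw n
      simpa [t] using this
  have := (hm w).mono hsub
  rw [← hG.closure_eq, this.closure_eq]

theorem IsMinimalHomeo.symm {Z : Type u} [TopologicalSpace Z] {h : Z ≃ₜ Z}
    (hm : IsMinimalHomeo h) : IsMinimalHomeo h.symm := by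
  intro z
  refine (hm z).mono ?_
  rintro _ ⟨k, rfl⟩
  refine ⟨-k, ?_⟩
  show ((h⁻¹) ^ (-k)) z = _
  simp

section Product

variable {X : Type u} {S : Type} [TopologicalSpace X] [TopologicalSpace S]

theorem prodCongr_zpow (α : X ≃ₜ X) (β : S ≃ₜ S) (k : ℤ) :
    (α.prodCongr β) ^ k = (α ^ k).prodCongr (β ^ k) := by
  induction k with
  | zero => rfl
  | succ n ih =>
    rw [zpow_add_one, ih, zpow_add_one, zpow_add_one]; rfl
  | pred n ih =>
    rw [zpow_sub_one, ih, zpow_sub_one, zpow_sub_one]; rfl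

/-- The base of a minimal product homeomorphism over an infinite base acts freely. -/
theorem IsMinimalHomeo.zpow_apply_ne [T1Space X] [PerfectSpace X] [Nonempty S] {α : X ≃ₜ X}
    {β : S ≃ₜ S} (hm : IsMinimalHomeo (α.prodCongr β)) {k : ℤ} (hk : k ≠ 0) (x : X) :
    (α ^ k) x ≠ x := by
  intro hx
  obtain ⟨s⟩ := ‹Nonempty S›
  have hd : Dense (Set.range fun j : ℤ => (α ^ j) x) := by
    have := (Prod.fst_surjective (α := X) (β := S)).denseRange.dense_image continuous_fst (hm (x, s))
    refine this.mono ?_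
    rintro _ ⟨_, ⟨j, rfl⟩, rfl⟩
    exact ⟨j, by simp [prodCongr_zpow]⟩
  have hmod : ∀ j q : ℤ, (α ^ (j + k * q)) x = (α ^ j) x := by
    intro j q
    have hfix : (α ^ (k * q)) x = x := by
      rw [zpow_mul]
      induction q with
      | zero => rfl
      | succ n ih => rw [zpow_add_one, Homeomorph.mul_apply, hx, ih]
      | pred n ih =>
        rw [zpow_sub_one, Homeomorph.mul_apply,
          show (α ^ k)⁻¹ x = x from (Homeomorph.symm_apply_eq (α ^ k)).2 hx.symm, ih]
    rw [zpow_add, Homeomorph.mul_apply, hfix]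
  have hfin : (Set.range fun j : ℤ => (α ^ j) x).Finite := by
    refine ((Set.finite_Ico (0 : ℤ) |k|).image fun j : ℤ => (α ^ j) x).subset ?_
    rintro _ ⟨j, rfl⟩
    refine ⟨j % k, ⟨Int.emod_nonneg _ hk, Int.emod_lt_abs _ hk⟩, ?_⟩
    simpa using (hmod (j % k) (j / k)).symm.trans (by rw [Int.emod_add_mul_ediv])
  have huniv : (Set.univ : Set X).Finite := by
    rw [← hd.closure_eq, hfin.isClosed.closure_eq]
    exact hfin
  exact infinite_of_mem_nhds x Filter.univ_mem huniv

/-- A free homeomorphism of a compact totally disconnected Hausdorff space admits colourings by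
roots of unity that separate any finitely many iterates. -/
theorem exists_coloring [CompactSpace X] [T2Space X] [TotallyDisconnectedSpace X] {α : X ≃ₜ X}
    (hα : ∀ k : ℤ, k ≠ 0 → ∀ x, (α ^ k) x ≠ x) (N : ℕ) :
    ∃ M : ℕ, M ≠ 0 ∧ ∃ v : C(X, ℂ), v ^ M = 1 ∧
      ∀ k : ℤ, k ≠ 0 → |k| ≤ N → ∀ x, v ((α ^ k) x) ≠ v x := by
  have hloc : ∀ x, ∃ W : Set X, IsClopen W ∧ x ∈ W ∧
      ∀ k ∈ (Finset.Icc (-N : ℤ) N).erase 0, ∀ w ∈ W, (α ^ k) w ∉ W := by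
    intro x
    have hk : ∀ k : ℤ, ∃ W : Set X, IsClopen W ∧ x ∈ W ∧ (k ≠ 0 → ∀ w ∈ W, (α ^ k) w ∉ W) := by
      intro k
      by_cases hk : k = 0
      · exact ⟨Set.univ, isClopen_univ, trivial, fun h => absurd hk h⟩
      obtain ⟨V, hV, hxV, hV'⟩ := exists_isClopen_of_totally_separated (hα k hk x).symm
      refine ⟨V ∩ (α ^ k) ⁻¹' Vᶜ, hV.inter (hV.compl.preimage (α ^ k).continuous), ⟨hxV, hV'⟩,
        fun _ w hw hw' => hw.2 hw'.1⟩
    choose W hW hxW hW' using hk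
    refine ⟨⋂ k ∈ (Finset.Icc (-N : ℤ) N).erase 0, W k,
      isClopen_biInter_finset fun k _ => hW k, by simpa using fun k _ _ _ => hxW k, ?_⟩
    intro k hk w hw hw'
    exact hW' k (Finset.ne_of_mem_erase hk) w (Set.mem_iInter₂.1 hw k hk)
      (Set.mem_iInter₂.1 hw' k hk)
  choose W hW hxW hW' using hloc
  obtain ⟨t, ht⟩ := isCompact_univ.elim_nhds_subcover W fun x _ => (hW x).isOpen.mem_nhds (hxW x)
  let c : X → (t → Bool) := fun x i => (W i).boolIndicator x
  have hc : Continuous c := continuous_pi fun i =>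
    (continuous_boolIndicator_iff_isClopen _).2 (hW i)
  have hcne : ∀ k : ℤ, k ≠ 0 → |k| ≤ N → ∀ x, c ((α ^ k) x) ≠ c x := by
    intro k hk hkN x hcx
    obtain ⟨i, hi, hxi⟩ := Set.mem_iUnion₂.1 (ht.2 (Set.mem_univ x))
    have h1 : (α ^ k) x ∈ W i := by
      rw [Set.mem_iff_boolIndicator, show (W i).boolIndicator ((α ^ k) x) = c ((α ^ k) x) ⟨i, hi⟩
        from rfl, hcx]
      exact (Set.mem_iff_boolIndicator _ _).1 hxi
    refine hW' i k ?_ x hxi h1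
    simpa [hk] using abs_le.1 hkN
  classical
  let M := Fintype.card (t → Bool)
  have hM : M ≠ 0 := Fintype.card_ne_zero
  let e : (t → Bool) ≃ Fin M := Fintype.equivFin _
  let ω : ℂ := Complex.exp (2 * Real.pi * Complex.I / M)
  have hω : IsPrimitiveRoot ω M := Complex.isPrimitiveRoot_exp M hM
  refine ⟨M, hM, ⟨fun x => ω ^ (e (c x) : ℕ),
    (continuous_of_discreteTopology (f := fun i => ω ^ (e i : ℕ))).comp hc⟩, ?_, ?_⟩
  · ext x
    simp [← pow_mul, mul_comm _ M, pow_mul ω M, hω.pow_eq_one]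
  · intro k hk hkN x hx
    exact hcne k hk hkN x (e.injective (Fin.ext (hω.pow_inj (Fin.is_lt _) (Fin.is_lt _) hx)))

end Product

section PairProduct
variable {Z : Type u} [TopologicalSpace Z] [CompactSpace Z]

/-- `pairFun` as a ⋆-homomorphism. -/
def pairHom (h : Z ≃ₜ Z) : C(Z, ℂ) →⋆ₐ[ℂ] PairProduct h where
  toFun := pairFun h
  map_one' := by ext P; exact map_one P.π
  map_mul' f g := by ext P; exact map_mul P.π f g
  map_zero' := by ext P; exact map_zero P.π
  map_add' f g := by ext P; exact map_add P.π f g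
  commutes' c := by ext P; exact AlgHomClass.commutes P.π c
  map_star' f := by ext P; exact map_star P.π f

/-- `pairUnitary` as an element of the unitary group. -/
def pairU (h : Z ≃ₜ Z) : unitary (PairProduct h) :=
  ⟨pairUnitary h, by
    rw [Unitary.mem_iff]
    constructor
    · ext P; exact Unitary.coe_star_mul_self P.U
    · ext P; exact Unitary.coe_mul_star_self P.U⟩

theorem pairU_mul_pairHom (h : Z ≃ₜ Z) (f : C(Z, ℂ)) :
    (pairU h : PairProduct h) * pairHom h f =
      pairHom h (f.comp (h.symm : C(Z, Z))) * pairU h := by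
  have : (pairU h : PairProduct h) * pairHom h f * star (pairU h : PairProduct h) =
      pairHom h (f.comp (h.symm : C(Z, Z))) := by
    ext P; exact P.covariant f
  rw [← this, mul_assoc, Unitary.coe_star_mul_self, mul_one]

theorem pairU_zpow_mul_pairHom (h : Z ≃ₜ Z) (k : ℤ) (f : C(Z, ℂ)) :
    ((pairU h ^ k : unitary _) : PairProduct h) * pairHom h f =
      pairHom h (f.comp ((h ^ k).symm : C(Z, Z))) * ((pairU h ^ k : unitary _) : PairProduct h) := by
  have hinv : ∀ f : C(Z, ℂ), ((pairU h)⁻¹ : unitary _) * pairHom h f =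
      pairHom h (f.comp (h : C(Z, Z))) * (((pairU h)⁻¹ : unitary _) : PairProduct h) := by
    intro f
    have h1 := pairU_mul_pairHom h (f.comp (h : C(Z, Z)))
    have h2 : (f.comp (h : C(Z, Z))).comp (h.symm : C(Z, Z)) = f := by ext; simp
    rw [h2] at h1
    calc _ = ((pairU h)⁻¹ : unitary _) * (pairHom h f * pairU h) *
          (((pairU h)⁻¹ : unitary _) : PairProduct h) := by
            rw [mul_assoc, mul_assoc, ← Submonoid.coe_mul, mul_inv_cancel, Submonoid.coe_one, mul_one]
      _ = _ := by
            rw [← h1, ← mul_assoc, ← Submonoid.coe_mul, inv_mul_cancel, Submonoid.coe_one, one_mul]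
  induction k generalizing f with
  | zero => simp; rfl
  | succ n ih =>
    rw [zpow_add_one, Submonoid.coe_mul, mul_assoc, pairU_mul_pairHom, ← mul_assoc, ih, mul_assoc,
      zpow_add_one]
    rfl
  | pred n ih =>
    rw [zpow_sub_one, Submonoid.coe_mul, mul_assoc, hinv, ← mul_assoc, ih, mul_assoc,
      zpow_sub_one]
    rfl

/-- The monomials `f u ^ k`. -/
def monomials (h : Z ≃ₜ Z) : Submonoid (PairProduct h) where
  carrier := {a | ∃ (f : C(Z, ℂ)) (k : ℤ), a = pairHom h f * (pairU h ^ k : unitary _)}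
  one_mem' := ⟨1, 0, by simp⟩
  mul_mem' := by
    rintro _ _ ⟨f, k, rfl⟩ ⟨g, l, rfl⟩
    refine ⟨f * g.comp ((h ^ k).symm : C(Z, Z)), k + l, ?_⟩
    rw [mul_assoc, ← mul_assoc (((pairU h ^ k : unitary _) : PairProduct h)),
      pairU_zpow_mul_pairHom, map_mul, zpow_add, Submonoid.coe_mul]
    simp only [mul_assoc]

theorem pairHom_mem_monomials (h : Z ≃ₜ Z) (f : C(Z, ℂ)) : pairHom h f ∈ monomials h :=
  ⟨f, 0, by simp⟩

theorem pairU_zpow_mem_monomials (h : Z ≃ₜ Z) (k : ℤ) :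
    ((pairU h ^ k : unitary _) : PairProduct h) ∈ monomials h :=
  ⟨1, k, by simp⟩

theorem crossedProductIn_le (h : Z ≃ₜ Z) {a : PairProduct h} (ha : a ∈ crossedProductIn h) :
    a ∈ closure (Submodule.span ℂ (monomials h : Set (PairProduct h)) : Set (PairProduct h)) := by
  refine closure_mono ?_ (show a ∈ closure (_ : Set (PairProduct h)) from ha)
  intro b hb
  have hb' : b ∈ Subalgebra.toSubmodule (StarAlgebra.adjoin ℂ
    (Set.range (pairFun h) ∪ {pairUnitary h})).toSubalgebra := hb
  rw [StarAlgebra.adjoin_toSubalgebra, Algebra.adjoin_eq_span] at hb'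
  refine Submodule.span_mono ?_ hb'
  rw [SetLike.coe_subset_coe, Submonoid.closure_le]
  rintro x ((⟨f, rfl⟩ | rfl) | hx)
  · exact pairHom_mem_monomials h f
  · have := pairU_zpow_mem_monomials h 1
    rwa [zpow_one] at this
  · rcases hx with ⟨f, hf⟩ | hx
    · rw [← star_star x, ← hf]
      exact map_star (pairHom h) f ▸ pairHom_mem_monomials h (star f)
    · rw [← star_star x, Set.mem_singleton_iff.1 hx]
      have := pairU_zpow_mem_monomials h (-1)
      rwa [zpow_neg_one, ← Unitary.star_eq_inv] at this

/-- The covariant pair with the unitary multiplied by a scalar of modulus one. -/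
def CovariantPair.twist {h : Z ≃ₜ Z} (P : CovariantPair h) (t : Circle) : CovariantPair h where
  B := P.B
  π := P.π
  U := ⟨(t : ℂ) • (P.U : P.B), by
    have : (t : ℂ) * (starRingEnd ℂ) t = 1 := by
      rw [Complex.mul_conj', Circle.norm_coe]
      simp
    rw [Unitary.mem_iff]
    simp [smul_smul, mul_comm, this]⟩
  covariant f := by
    have : (t : ℂ) * (starRingEnd ℂ) t = 1 := by
      rw [Complex.mul_conj', Circle.norm_coe]
      simp
    simp [smul_smul, ← P.covariant f, mul_comm, this]

/-- The gauge action. -/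
def gauge (h : Z ≃ₜ Z) (t : Circle) : PairProduct h →⋆ₐ[ℂ] PairProduct h where
  toFun a := ⟨fun P => a (P.twist t), memℓp_infty ⟨‖a‖, by
    rintro _ ⟨P, rfl⟩
    exact lp.norm_apply_le_norm (by simp) a (P.twist t)⟩⟩
  map_one' := rfl
  map_mul' _ _ := rfl
  map_zero' := rfl
  map_add' _ _ := rfl
  commutes' _ := rfl
  map_star' _ := rfl

theorem gauge_pairHom (h : Z ≃ₜ Z) (t : Circle) (f : C(Z, ℂ)) :
    gauge h t (pairHom h f) = pairHom h f := rfl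

theorem gauge_pairU (h : Z ≃ₜ Z) (t : Circle) :
    gauge h t (pairU h) = (t : ℂ) • (pairU h : PairProduct h) := rfl

theorem gauge_pairU_zpow (h : Z ≃ₜ Z) (t : Circle) (k : ℤ) :
    gauge h t (pairU h ^ k : unitary _) =
      ((t : ℂ) ^ k) • ((pairU h ^ k : unitary _) : PairProduct h) := by
  have ht : (t : ℂ) ≠ 0 := t.coe_ne_zero
  induction k with
  | zero => simp
  | succ n ih =>
    rw [zpow_add_one, Submonoid.coe_mul, map_mul, ih, gauge_pairU, zpow_add_one₀ ht,
      smul_mul_smul_comm]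
  | pred n ih =>
    have : gauge h t ((pairU h)⁻¹ : unitary _) =
        (t : ℂ)⁻¹ • (((pairU h)⁻¹ : unitary _) : PairProduct h) := by
      rw [← Unitary.star_eq_inv, Unitary.coe_star, map_star, gauge_pairU, star_smul]
      congr 1
      simp [← Circle.coe_inv_eq_conj]
    rw [zpow_sub_one, Submonoid.coe_mul, map_mul, ih, this, zpow_sub_one₀ ht,
      smul_mul_smul_comm]

theorem gauge_monomial (h : Z ≃ₜ Z) (t : Circle) (f : C(Z, ℂ)) (k : ℤ) :
    gauge h t (pairHom h f * (pairU h ^ k : unitary _)) =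
      ((t : ℂ) ^ k) • (pairHom h f * (pairU h ^ k : unitary _)) := by
  rw [map_mul, gauge_pairHom, gauge_pairU_zpow, mul_smul_comm]

theorem norm_gauge_le (h : Z ≃ₜ Z) (t : Circle) (a : PairProduct h) : ‖gauge h t a‖ ≤ ‖a‖ :=
  NonUnitalStarAlgHom.norm_apply_le (gauge h t) a

end PairProduct

section PairProduct
variable {Z : Type u} [TopologicalSpace Z] [CompactSpace Z]

theorem tendsto_zpow_smul_sub {V : Type*} [NormedAddCommGroup V] [NormedSpace ℂ V] (k : ℤ) (m : V) :
    Tendsto (fun t : Circle => ((t : ℂ) ^ k) • m - m) (𝓝 1) (𝓝 0) := by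
  have h1 : Tendsto (fun t : Circle => ((t ^ k : Circle) : ℂ)) (𝓝 1)
      (𝓝 ((1 ^ k : Circle) : ℂ)) :=
    (Continuous.comp (g := ((↑) : Circle → ℂ)) (by fun_prop) (continuous_zpow (G := Circle) k)).tendsto 1
  simp only [one_zpow, Circle.coe_one, Circle.coe_zpow] at h1
  have h2 := (h1.smul_const m).sub_const m
  rwa [one_smul, sub_self] at h2

theorem tendsto_gauge (h : Z ≃ₜ Z) {a : PairProduct h} (ha : a ∈ crossedProductIn h) :
    Tendsto (fun t => gauge h t a) (𝓝 1) (𝓝 a) := by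
  let T : Circle → PairProduct h →ₗ[ℂ] PairProduct h := fun t =>
    (gauge h t).toAlgHom.toLinearMap - LinearMap.id
  have hbound : ∀ (t : Circle) (x : PairProduct h),
      ‖T t x‖ ≤ 2 * ‖x‖ := by
    intro t x
    have h1 := norm_gauge_le h t x
    have h2 := norm_sub_le (gauge h t x) x
    change ‖gauge h t x - x‖ ≤ _
    linarith
  have hgen : ∀ x ∈ (monomials h : Set (PairProduct h)), ∃ y ∈ (⊥ : Submodule ℂ (PairProduct h)),
      Tendsto (fun t => T t x) (𝓝 1) (𝓝 y) := by
    rintro _ ⟨f, k, rfl⟩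
    refine ⟨0, Submodule.zero_mem _, ?_⟩
    change Tendsto (fun t : Circle => gauge h t (pairHom h f * (pairU h ^ k : unitary _)) -
      pairHom h f * (pairU h ^ k : unitary _)) (𝓝 1) (𝓝 0)
    simp only [gauge_monomial]
    exact tendsto_zpow_smul_sub k _
  obtain ⟨y, hy, hy'⟩ := exists_tendsto_of_mem_closure_span T 2 hbound ⊥ (by simp) _ hgen
    (crossedProductIn_le h ha)
  rw [(Submodule.mem_bot ℂ).1 hy] at hy'
  have := hy'.add_const a
  rw [zero_add] at this
  refine this.congr fun t => ?_
  exact sub_add_cancel (gauge h t a) a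

/-- The point `exp (2πi j / M)` of the circle. -/
def rootOfUnity (M j : ℕ) : Circle := Circle.exp (2 * Real.pi * j / M)

/-- The average of the gauge action over the `M`-th roots of unity. -/
def gaugeAverage (h : Z ≃ₜ Z) (M : ℕ) : PairProduct h →ₗ[ℂ] PairProduct h :=
  average M fun j => (gauge h (rootOfUnity M j)).toAlgHom.toLinearMap

theorem gaugeAverage_apply (h : Z ≃ₜ Z) (M : ℕ) (a : PairProduct h) :
    gaugeAverage h M a = (M : ℂ)⁻¹ • ∑ j ∈ Finset.range M, gauge h (rootOfUnity M j) a :=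
  average_apply _ _ _

theorem norm_gaugeAverage_le (h : Z ≃ₜ Z) (M : ℕ) (a : PairProduct h) :
    ‖gaugeAverage h M a‖ ≤ ‖a‖ :=
  norm_average_le _ _ (fun _ => norm_gauge_le h _) _

theorem gaugeAverage_pairHom (h : Z ≃ₜ Z) {M : ℕ} (hM : M ≠ 0) (f : C(Z, ℂ)) :
    gaugeAverage h M (pairHom h f) = pairHom h f := by
  rw [gaugeAverage_apply]
  simp only [gauge_pairHom, Finset.sum_const, Finset.card_range]
  rw [← Nat.cast_smul_eq_nsmul ℂ, smul_smul, inv_mul_cancel₀ (by exact_mod_cast hM), one_smul]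

theorem gaugeAverage_monomial (h : Z ≃ₜ Z) {M : ℕ} (f : C(Z, ℂ)) {k : ℤ} (hk : k ≠ 0)
    (hkM : |k| < M) : gaugeAverage h M (pairHom h f * (pairU h ^ k : unitary _)) = 0 := by
  have hM : M ≠ 0 := by
    rintro rfl
    exact absurd hkM (by simp)
  rw [gaugeAverage_apply]
  simp only [gauge_monomial, ← Finset.sum_smul]
  have hω := Complex.isPrimitiveRoot_exp M hM
  have : ∑ j ∈ Finset.range M, ((rootOfUnity M j : Circle) : ℂ) ^ k = 0 := by
    rw [← sum_range_pow_eq_zero (ζ := Complex.exp (2 * Real.pi * Complex.I / M) ^ k) (M := M)]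
    · refine Finset.sum_congr rfl fun j _ => ?_
      rw [rootOfUnity, Circle.coe_exp, ← zpow_natCast, ← zpow_mul, ← Complex.exp_int_mul,
        ← Complex.exp_int_mul]
      congr 1
      push_cast
      ring
    · rw [Ne, hω.zpow_eq_one_iff_dvd]
      intro hd
      exact absurd (Int.le_of_dvd (abs_pos.2 hk) ((dvd_abs _ _).2 hd)) (not_le.2 hkM)
    · rw [← zpow_natCast, ← zpow_mul, mul_comm k, zpow_mul, zpow_natCast, hω.pow_eq_one, one_zpow]
  rw [this, zero_smul, smul_zero]

/-- Faithfulness of the canonical conditional expectation. -/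
theorem eq_zero_of_tendsto_gaugeAverage (h : Z ≃ₜ Z) {a : PairProduct h}
    (ha : a ∈ crossedProductIn h)
    (hlim : Tendsto (fun M => gaugeAverage h M (star a * a)) atTop (𝓝 0)) : a = 0 := by
  by_contra hne
  set c := star a * a with hc
  have hcA : c ∈ crossedProductIn h := mul_mem (star_mem ha) ha
  have hcpos : 0 < ‖c‖ := by
    rw [hc, CStarRing.norm_star_mul_self]
    have := norm_pos_iff.2 hne
    positivity
  have hev : ∀ᶠ t : Circle in 𝓝 1, dist (gauge h t c) c < ‖c‖ / 2 :=
    Metric.tendsto_nhds.1 (tendsto_gauge h hcA) _ (by positivity)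
  have hexp : Tendsto (fun x : ℝ => Circle.exp x) (𝓝 0) (𝓝 1) := by
    have := Circle.exp.continuous.tendsto 0
    simpa using this
  obtain ⟨δ, hδ, hball⟩ := Metric.eventually_nhds_iff.1 (hexp.eventually hev)
  obtain ⟨L, hL⟩ := exists_nat_gt (2 * Real.pi / δ)
  have hL0 : (0 : ℝ) < L := lt_trans (by positivity) hL
  have hlow : ∀ K : ℕ, 0 < K → ‖c‖ / (2 * L) ≤ ‖gaugeAverage h (L * K) c‖ := by
    intro K hK
    have hK0 : (0 : ℝ) < K := by exact_mod_cast hK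
    have hLn : 0 < L := by exact_mod_cast hL0
    have hclose : ∀ j ∈ Finset.range K,
        ‖c - gauge h (rootOfUnity (L * K) j) c‖ ≤ ‖c‖ / 2 := by
      intro j hj
      rw [← dist_eq_norm, dist_comm]
      refine (hball ?_).le
      have hjK : (j : ℝ) < K := by exact_mod_cast Finset.mem_range.1 hj
      rw [Real.dist_eq, sub_zero, abs_of_nonneg (by positivity)]
      push_cast
      rw [div_lt_iff₀ (by positivity)]
      rw [div_lt_iff₀ hδ] at hL
      have hpi := Real.pi_pos
      calc 2 * Real.pi * j ≤ 2 * Real.pi * K := by gcongr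
        _ < L * δ * K := by gcongr
        _ = δ * (L * K) := by ring
    have hsub : (K : ℝ) * (‖c‖ / 2) ≤
        ‖∑ j ∈ Finset.range K, gauge h (rootOfUnity (L * K) j) c‖ := by
      have h1 : ‖∑ j ∈ Finset.range K, (c - gauge h (rootOfUnity (L * K) j) c)‖ ≤
          K * (‖c‖ / 2) := by
        refine (norm_sum_le_of_le _ hclose).trans ?_
        simp
      rw [Finset.sum_sub_distrib, Finset.sum_const, Finset.card_range] at h1
      have h2 := norm_sub_norm_le (K • c) (∑ j ∈ Finset.range K, gauge h (rootOfUnity (L * K) j) c)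
      have h3 : ‖K • c‖ = K * ‖c‖ := by
        rw [← Nat.cast_smul_eq_nsmul ℂ, norm_smul, Complex.norm_natCast]
      linarith
    have hmono := norm_sum_le_norm_sum_of_subset
      (Finset.range_subset_range.2 (Nat.le_mul_of_pos_left K hLn))
      (fun j => gauge h (rootOfUnity (L * K) j) a)
    simp only [← map_star, ← map_mul] at hmono
    rw [gaugeAverage_apply, norm_smul, norm_inv, Complex.norm_natCast]
    push_cast
    calc ‖c‖ / (2 * L) = (L * K : ℝ)⁻¹ * (K * (‖c‖ / 2)) := by field_simp
      _ ≤ _ := by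
        gcongr
        exact hsub.trans hmono
  have hsubseq : Tendsto (fun K : ℕ => ‖gaugeAverage h (L * K) c‖) atTop (𝓝 0) := by
    have := hlim.norm.comp (tendsto_id.const_mul_atTop' (show 0 < L by exact_mod_cast hL0))
    simpa [Function.comp_def] using this
  have := ge_of_tendsto hsubseq ((eventually_gt_atTop 0).mono hlow)
  have hp : 0 < ‖c‖ / (2 * L) := by positivity
  linarith

/-- The average of the conjugates of `a` by the first `M` powers of `v`. -/
def conjAverage (h : Z ≃ₜ Z) (M : ℕ) (v : C(Z, ℂ)) : PairProduct h →ₗ[ℂ] PairProduct h :=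
  average M fun j => LinearMap.mulLeft ℂ (pairHom h (v ^ j)) ∘ₗ
    LinearMap.mulRight ℂ (pairHom h (star v ^ j))

theorem conjAverage_apply (h : Z ≃ₜ Z) (M : ℕ) (v : C(Z, ℂ)) (a : PairProduct h) :
    conjAverage h M v a =
      (M : ℂ)⁻¹ • ∑ j ∈ Finset.range M, pairHom h (v ^ j) * (a * pairHom h (star v ^ j)) :=
  average_apply _ _ _

theorem norm_conjAverage_le (h : Z ≃ₜ Z) (M : ℕ) {v : C(Z, ℂ)} (hv : star v * v = 1)
    (a : PairProduct h) : ‖conjAverage h M v a‖ ≤ ‖a‖ := by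
  refine norm_average_le _ _ (fun j x => ?_) _
  have hu : pairHom h (v ^ j) ∈ unitary (PairProduct h) := by
    rw [Unitary.mem_iff, ← map_star, ← map_mul, ← map_mul, star_pow, ← mul_pow, ← mul_pow,
      mul_comm v, hv]
    simp
  have hu' : pairHom h (star v ^ j) ∈ unitary (PairProduct h) := by
    rw [← star_pow, map_star]
    exact Unitary.star_mem hu
  change ‖pairHom h (v ^ j) * (x * pairHom h (star v ^ j))‖ ≤ ‖x‖
  rw [CStarRing.norm_mem_unitary_mul _ hu, CStarRing.norm_mul_mem_unitary _ hu']

theorem conjAverage_monomial (h : Z ≃ₜ Z) (M : ℕ) (v f : C(Z, ℂ)) (k : ℤ) :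
    conjAverage h M v (pairHom h f * (pairU h ^ k : unitary _)) =
      pairHom h (f * ((M : ℂ)⁻¹ • ∑ j ∈ Finset.range M,
        (v * (star v).comp ((h ^ k).symm : C(Z, Z))) ^ j)) * (pairU h ^ k : unitary _) := by
  rw [conjAverage_apply, mul_smul_comm, map_smul, smul_mul_assoc, Finset.mul_sum, map_sum,
    Finset.sum_mul]
  congr 1
  refine Finset.sum_congr rfl fun j _ => ?_
  rw [mul_assoc (pairHom h f), pairU_zpow_mul_pairHom, ← mul_assoc, ← mul_assoc, ← map_mul,
    ← map_mul]
  congr 2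
  rw [mul_pow, mul_comm (v ^ j), mul_assoc]
  rfl

theorem conjAverage_pairHom (h : Z ≃ₜ Z) {M : ℕ} (hM : M ≠ 0) {v : C(Z, ℂ)}
    (hv : star v * v = 1) (f : C(Z, ℂ)) : conjAverage h M v (pairHom h f) = pairHom h f := by
  have h1 := conjAverage_monomial h M v f 0
  have h2 : v * (star v).comp ((h ^ (0 : ℤ)).symm : C(Z, Z)) = 1 := by
    rw [← hv, mul_comm]; rfl
  rw [h2] at h1
  have hM' : (M : ℂ) ≠ 0 := by exact_mod_cast hM
  have h3 : (M : ℂ)⁻¹ • ∑ j ∈ Finset.range M, (1 : C(Z, ℂ)) ^ j = 1 := by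
    ext; simp [hM']
  rw [h3] at h1
  simpa using h1

theorem conjAverage_monomial_eq_zero (h : Z ≃ₜ Z) {M : ℕ} {v : C(Z, ℂ)} (hvM : v ^ M = 1)
    (hv : star v * v = 1) {k : ℤ} (hk : ∀ z, v ((h ^ k) z) ≠ v z) (f : C(Z, ℂ)) :
    conjAverage h M v (pairHom h f * (pairU h ^ k : unitary _)) = 0 := by
  rw [conjAverage_monomial]
  have : (M : ℂ)⁻¹ • ∑ j ∈ Finset.range M,
        (v * (star v).comp ((h ^ k).symm : C(Z, Z))) ^ j = 0 := by
    ext z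
    have hM : ∀ w, v w ^ M = 1 := fun w => by simpa using DFunLike.congr_fun hvM w
    have hs : ∀ w, star (v w) * v w = 1 := fun w => by simpa using DFunLike.congr_fun hv w
    set w := (h ^ k).symm z with hw
    have hz : (h ^ k) w = z := (h ^ k).apply_symm_apply z
    have h0 : ∑ j ∈ Finset.range M, (v z * star (v w)) ^ j = 0 := by
      refine sum_range_pow_eq_zero (fun h1 => hk w ?_) ?_
      · rw [hz]
        calc v z = v z * (star (v w) * v w) := by rw [hs, mul_one]
          _ = v w := by rw [← mul_assoc, h1, one_mul]
      · rw [mul_pow, hM, ← star_pow, hM, star_one, one_mul]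
    have h0' : ∑ j ∈ Finset.range M, (v z * (starRingEnd ℂ) (v w)) ^ j = 0 := h0
    simp [← hw, h0']
  rw [this, mul_zero, map_zero, zero_mul]

theorem star_mul_self_eq_one_of_pow_eq_one {M : ℕ} (hM : M ≠ 0) {v : C(Z, ℂ)} (hv : v ^ M = 1) :
    star v * v = 1 := by
  ext z
  have h1 : v z ^ M = 1 := by simpa using DFunLike.congr_fun hv z
  have h2 : ‖v z‖ = 1 := Complex.norm_eq_one_of_pow_eq_one h1 hM
  simp [Complex.conj_mul', h2]

end PairProduct

section RegularRepresentation
variable {Z : Type u}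

/-- The unitary on `ℓ²(Z)` induced by a permutation of `Z`. -/
def lpPerm (e : Z ≃ Z) : lp (fun _ : Z => ℂ) 2 ≃ₗᵢ[ℂ] lp (fun _ : Z => ℂ) 2 where
  toFun ξ := ⟨fun z => ξ (e.symm z), by
    have h2 : 0 < (2 : ℝ≥0∞).toReal := by simp
    exact (memℓp_gen_iff h2).2
      (e.symm.summable_iff.2 ((memℓp_gen_iff h2).1 (lp.memℓp ξ)))⟩
  invFun ξ := ⟨fun z => ξ (e z), by
    have h2 : 0 < (2 : ℝ≥0∞).toReal := by simp
    exact (memℓp_gen_iff h2).2 (e.summable_iff.2 ((memℓp_gen_iff h2).1 (lp.memℓp ξ)))⟩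
  map_add' _ _ := rfl
  map_smul' _ _ := rfl
  left_inv ξ := by ext z; exact congrArg ξ (e.symm_apply_apply z)
  right_inv ξ := by ext z; exact congrArg ξ (e.apply_symm_apply z)
  norm_map' ξ := by
    have h2 : 0 < (2 : ℝ≥0∞).toReal := by simp
    rw [lp.norm_eq_tsum_rpow h2, lp.norm_eq_tsum_rpow h2]
    congr 1
    exact e.symm.tsum_eq fun z => ‖ξ z‖ ^ (2 : ℝ≥0∞).toReal

variable [TopologicalSpace Z] [CompactSpace Z]

/-- The multiplication operator on `ℓ²(Z)` by a continuous function. -/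
def lpMul (f : C(Z, ℂ)) : lp (fun _ : Z => ℂ) 2 →L[ℂ] lp (fun _ : Z => ℂ) 2 :=
  lp.mapCLM 2 (fun z => f z • ContinuousLinearMap.id ℂ ℂ) (norm_nonneg f) fun z => by
    simpa [norm_smul] using f.norm_coe_le_norm z

theorem lpMul_apply (f : C(Z, ℂ)) (ξ : lp (fun _ : Z => ℂ) 2) (z : Z) :
    lpMul f ξ z = f z * ξ z := rfl

/-- The representation of `C(Z)` on `ℓ²(Z)` by multiplication operators. -/
def lpMulHom : C(Z, ℂ) →⋆ₐ[ℂ] (lp (fun _ : Z => ℂ) 2 →L[ℂ] lp (fun _ : Z => ℂ) 2) where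
  toFun := lpMul
  map_one' := by ext ξ z; simp [lpMul_apply]
  map_mul' f g := by ext ξ z; simp [lpMul_apply, mul_assoc]
  map_zero' := by ext ξ z; simp [lpMul_apply]
  map_add' f g := by ext ξ z; simp [lpMul_apply, add_mul]
  commutes' c := by ext ξ z; simp [lpMul_apply, Algebra.algebraMap_eq_smul_one]
  map_star' f := by
    rw [ContinuousLinearMap.star_eq_adjoint, ContinuousLinearMap.eq_adjoint_iff]
    intro ξ η
    rw [lp.inner_eq_tsum, lp.inner_eq_tsum]
    refine tsum_congr fun z => ?_
    simp [lpMul_apply]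
    ring

/-- The covariant pair on `ℓ²(Z)` given by multiplication operators and the permutation `h`. -/
def regularPair (h : Z ≃ₜ Z) [Nonempty Z] : CovariantPair h where
  B := lp (fun _ : Z => ℂ) 2 →L[ℂ] lp (fun _ : Z => ℂ) 2
  nontrivial := by
    classical
    obtain ⟨z⟩ := ‹Nonempty Z›
    refine ⟨⟨1, 0, fun h10 => ?_⟩⟩
    have := congrArg (fun T => T (lp.single 2 z (1 : ℂ)) z) h10
    simp at this
  π := lpMulHom
  U := Unitary.linearIsometryEquiv.symm (lpPerm h.toEquiv)
  covariant f := by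
    have hcov : ((Unitary.linearIsometryEquiv.symm (lpPerm h.toEquiv) : unitary _) :
          lp (fun _ : Z => ℂ) 2 →L[ℂ] lp (fun _ : Z => ℂ) 2) * lpMulHom f =
        lpMulHom (f.comp (h.symm : C(Z, Z))) *
          (Unitary.linearIsometryEquiv.symm (lpPerm h.toEquiv) : unitary _) := by
      ext ξ z
      rfl
    rw [hcov, mul_assoc, Unitary.mul_star_self_of_mem (SetLike.coe_mem _), mul_one]

theorem nontrivial_pairProduct (h : Z ≃ₜ Z) [Nonempty Z] : Nontrivial (PairProduct h) := by
  refine ⟨⟨1, 0, fun h10 => ?_⟩⟩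
  have := congrArg (fun a : PairProduct h => a (regularPair h)) h10
  exact one_ne_zero (α := (regularPair h).B) this

end RegularRepresentation

section PairProduct
variable {Z : Type u} [TopologicalSpace Z] [CompactSpace Z]

/-- `h` admits continuous colourings by roots of unity that separate any finitely many iterates. -/
def HasColorings (h : Z ≃ₜ Z) : Prop :=
  ∀ N : ℕ, ∃ M : ℕ, M ≠ 0 ∧ ∃ v : C(Z, ℂ), v ^ M = 1 ∧
    ∀ k : ℤ, k ≠ 0 → |k| ≤ N → ∀ z, v ((h ^ k) z) ≠ v z

/-- If `C(Z)` embeds in the crossed product, a subspace `J` of the crossed product that contains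
`a⋆ a` for each `a ∈ J`, is closed, is stable under conjugation by functions, and meets `C(Z)`
trivially, is zero. -/
theorem eq_zero_of_forall_pairHom_mem {h : Z ≃ₜ Z} (hcol : HasColorings h)
    (J : Submodule ℂ (PairProduct h)) (hJ : IsClosed (J : Set (PairProduct h)))
    (hconj : ∀ f g : C(Z, ℂ), ∀ a ∈ J, pairHom h f * (a * pairHom h g) ∈ J)
    (hmeet : ∀ f : C(Z, ℂ), pairHom h f ∈ J → f = 0)
    {a : PairProduct h} (ha : a ∈ crossedProductIn h) (haJ : star a * a ∈ J) : a = 0 := by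
  have hinj : Function.Injective (pairHom h) := by
    rw [injective_iff_map_eq_zero]
    intro f hf
    exact hmeet f (hf ▸ J.zero_mem)
  let R : Submodule ℂ (PairProduct h) := LinearMap.range (pairHom h).toAlgHom.toLinearMap
  have hR : IsClosed (R : Set (PairProduct h)) := by
    have := (NonUnitalStarAlgHom.isometry (pairHom h) hinj).isClosedEmbedding.isClosed_range
    exact this
  choose M hM v hvM hv using hcol
  have hv1 := fun N => star_mul_self_eq_one_of_pow_eq_one (hM N) (hvM N)
  let T : ℕ → PairProduct h →ₗ[ℂ] PairProduct h := fun N => conjAverage h (M N) (v N)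
  let E : ℕ → PairProduct h →ₗ[ℂ] PairProduct h := fun N => gaugeAverage h N
  set c := star a * a with hc
  have hcA : c ∈ closure (Submodule.span ℂ (monomials h : Set (PairProduct h)) :
      Set (PairProduct h)) := crossedProductIn_le h (mul_mem (star_mem ha) ha)
  have hTbound : ∀ N x, ‖T N x‖ ≤ 1 * ‖x‖ := fun N x => by
    rw [one_mul]; exact norm_conjAverage_le h _ (hv1 N) x
  have hTk : ∀ f (k : ℤ), k ≠ 0 →
      ∀ᶠ N in atTop, T N (pairHom h f * (pairU h ^ k : unitary _)) = 0 := by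
    intro f k hk
    filter_upwards [eventually_ge_atTop k.natAbs] with N hN
    exact conjAverage_monomial_eq_zero h (hvM N) (hv1 N) (hv N k hk (by rw [Int.abs_eq_natAbs]; exact_mod_cast hN)) f
  have hEk : ∀ f (k : ℤ), k ≠ 0 →
      ∀ᶠ N in atTop, E N (pairHom h f * (pairU h ^ k : unitary _)) = 0 := by
    intro f k hk
    filter_upwards [eventually_gt_atTop k.natAbs] with N hN
    exact gaugeAverage_monomial h f hk (by rw [Int.abs_eq_natAbs]; exact_mod_cast hN)
  obtain ⟨y, hyR, hy⟩ := exists_tendsto_of_mem_closure_span (l := atTop) T 1 hTbound R hR _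
    (by
      rintro _ ⟨f, k, rfl⟩
      by_cases hk : k = 0
      · refine ⟨pairHom h f, ⟨f, rfl⟩, ?_⟩
        refine tendsto_const_nhds.congr fun N => ?_
        rw [hk, zpow_zero, Submonoid.coe_one, mul_one]
        exact (conjAverage_pairHom h (hM N) (hv1 N) f).symm
      · exact ⟨0, R.zero_mem, tendsto_const_nhds.congr' ((hTk f k hk).mono fun N hN => hN.symm)⟩)
    hcA
  have hTEbound : ∀ N x, ‖(T N - E N) x‖ ≤ 2 * ‖x‖ := fun N x => by
    have h1 := norm_conjAverage_le h (M N) (hv1 N) x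
    have h2 := norm_gaugeAverage_le h N x
    have h3 := norm_sub_le (T N x) (E N x)
    rw [LinearMap.sub_apply]
    change ‖T N x‖ ≤ _ at h1
    change ‖E N x‖ ≤ _ at h2
    linarith
  obtain ⟨y', hy'0, hy'⟩ := exists_tendsto_of_mem_closure_span (l := atTop) (fun N => T N - E N) 2
    hTEbound ⊥ (by simp) _
    (by
      rintro _ ⟨f, k, rfl⟩
      refine ⟨0, Submodule.zero_mem _, tendsto_const_nhds.congr' ?_⟩
      by_cases hk : k = 0
      · filter_upwards [eventually_ne_atTop 0] with N hN
        rw [hk, zpow_zero, Submonoid.coe_one, mul_one, LinearMap.sub_apply]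
        exact (sub_eq_zero.2 ((conjAverage_pairHom h (hM N) (hv1 N) f).trans
          (gaugeAverage_pairHom h hN f).symm)).symm
      · filter_upwards [hTk f k hk, hEk f k hk] with N h1 h2
        rw [LinearMap.sub_apply, h1, h2, sub_zero])
    hcA
  have hTJ : ∀ N, T N c ∈ J := by
    intro N
    change conjAverage h (M N) (v N) c ∈ J
    rw [conjAverage_apply]
    exact J.smul_mem _ (J.sum_mem fun j _ => hconj _ _ _ haJ)
  have hyJ : y ∈ J := hJ.mem_of_tendsto hy (Eventually.of_forall hTJ)
  obtain ⟨f, rfl⟩ := hyR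
  have hf : f = 0 := hmeet f hyJ
  subst hf
  rw [map_zero] at hy
  rw [(Submodule.mem_bot ℂ).1 hy'0] at hy'
  refine eq_zero_of_tendsto_gaugeAverage h ha ?_
  have := hy.sub hy'
  rw [sub_zero] at this
  refine this.congr fun N => ?_
  rw [LinearMap.sub_apply, sub_sub_cancel]

end PairProduct

section FibreBreaking

variable {X : Type u} {S : Type} [TopologicalSpace X] [CompactSpace X]
  [TopologicalSpace S] [CompactSpace S]

/-- The inclusion of `A_Y` in the product of all covariant pairs. -/
def inclHom (h : X × S ≃ₜ X × S) (Y : Set X) : orbitBreaking h Y →⋆ₐ[ℂ] PairProduct h :=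
  (crossedProductIn h).subtype.comp (orbitBreaking h Y).subtype

theorem inclHom_injective (h : X × S ≃ₜ X × S) (Y : Set X) :
    Function.Injective (inclHom h Y) :=
  Subtype.val_injective.comp Subtype.val_injective

/-- The canonical map `C(X × S) → A_Y`. -/
def funHom (h : X × S ≃ₜ X × S) (Y : Set X) : C(X × S, ℂ) →⋆ₐ[ℂ] orbitBreaking h Y where
  toFun f := ⟨ofFun h f, StarSubalgebra.le_topologicalClosure _
    (StarAlgebra.subset_adjoin ℂ _ (Or.inl ⟨f, rfl⟩))⟩
  map_one' := inclHom_injective h Y (map_one (pairHom h))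
  map_mul' f g := inclHom_injective h Y (map_mul (pairHom h) f g)
  map_zero' := inclHom_injective h Y (map_zero (pairHom h))
  map_add' f g := inclHom_injective h Y (map_add (pairHom h) f g)
  commutes' c := inclHom_injective h Y (AlgHomClass.commutes (pairHom h) c)
  map_star' f := inclHom_injective h Y (map_star (pairHom h) f)

theorem inclHom_funHom (h : X × S ≃ₜ X × S) (Y : Set X) (f : C(X × S, ℂ)) :
    inclHom h Y (funHom h Y f) = pairHom h f := rfl

/-- The element `u g` of `A_Y`, for `g` vanishing on `Y × S`. -/
def shiftElem (h : X × S ≃ₜ X × S) (Y : Set X) (g : C(X × S, ℂ))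
    (hg : ∀ p : X × S, p.1 ∈ Y → g p = 0) : orbitBreaking h Y :=
  ⟨canonicalUnitary h * ofFun h g, StarSubalgebra.le_topologicalClosure _
    (StarAlgebra.subset_adjoin ℂ _ (Or.inr ⟨g, hg, rfl⟩))⟩

theorem inclHom_shiftElem (h : X × S ≃ₜ X × S) (Y : Set X) (g : C(X × S, ℂ))
    (hg : ∀ p : X × S, p.1 ∈ Y → g p = 0) :
    inclHom h Y (shiftElem h Y g hg) = pairU h * pairHom h g := rfl

theorem shiftElem_conj (h : X × S ≃ₜ X × S) (Y : Set X) (f g : C(X × S, ℂ))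
    (hg : ∀ p : X × S, p.1 ∈ Y → g p = 0) :
    shiftElem h Y g hg * funHom h Y f * star (shiftElem h Y g hg) =
      funHom h Y ((g * f * star g).comp (h.symm : C(X × S, X × S))) := by
  apply inclHom_injective
  rw [map_mul, map_mul, map_star, inclHom_shiftElem, inclHom_funHom, inclHom_funHom, star_mul,
    ← map_star, mul_assoc, mul_assoc, ← mul_assoc (pairHom h f), ← map_mul,
    ← mul_assoc (pairHom h g), ← map_mul, ← mul_assoc, pairU_mul_pairHom, mul_assoc,
    Unitary.mul_star_self_of_mem (SetLike.coe_mem _), mul_one, mul_assoc]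

theorem star_shiftElem_conj (h : X × S ≃ₜ X × S) (Y : Set X) (f g : C(X × S, ℂ))
    (hg : ∀ p : X × S, p.1 ∈ Y → g p = 0) :
    star (shiftElem h Y g hg) * funHom h Y f * shiftElem h Y g hg =
      funHom h Y (star g * f.comp (h : C(X × S, X × S)) * g) := by
  apply inclHom_injective
  have h1 : (f.comp (h : C(X × S, X × S))).comp (h.symm : C(X × S, X × S)) = f := by
    ext; simp
  have h2 : pairHom h f * (pairU h : PairProduct h) =
      pairU h * pairHom h (f.comp (h : C(X × S, X × S))) := by
    rw [pairU_mul_pairHom, h1]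
  rw [map_mul, map_mul, map_star, inclHom_shiftElem, inclHom_funHom, inclHom_funHom, star_mul,
    ← map_star, mul_assoc, mul_assoc, ← mul_assoc (pairHom h f), h2, mul_assoc, ← map_mul,
    ← mul_assoc (star _), Unitary.coe_star_mul_self, one_mul, ← map_mul, mul_assoc]

/-- The functions in a two-sided ideal of `A_Y`. -/
def funIdeal {h : X × S ≃ₜ X × S} {Y : Set X} (I : TwoSidedIdeal (orbitBreaking h Y)) :
    Ideal C(X × S, ℂ) :=
  (TwoSidedIdeal.asIdeal I).comap (funHom h Y : C(X × S, ℂ) →+* orbitBreaking h Y)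

theorem mem_funIdeal {h : X × S ≃ₜ X × S} {Y : Set X} {I : TwoSidedIdeal (orbitBreaking h Y)}
    {f : C(X × S, ℂ)} : f ∈ funIdeal I ↔ funHom h Y f ∈ I := Iff.rfl

/-- The common zeros of the functions in a two-sided ideal of `A_Y`. -/
def zeroSet {h : X × S ≃ₜ X × S} {Y : Set X} (I : TwoSidedIdeal (orbitBreaking h Y)) :
    Set (X × S) :=
  {z | ∀ f, funHom h Y f ∈ I → f z = 0}

theorem isClosed_zeroSet {h : X × S ≃ₜ X × S} {Y : Set X}
    (I : TwoSidedIdeal (orbitBreaking h Y)) : IsClosed (zeroSet I) := by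
  simp only [zeroSet, Set.ofPred_forall]
  exact isClosed_iInter fun f => isClosed_iInter fun _ =>
    isClosed_eq f.continuous continuous_const

theorem eq_top_of_zeroSet_eq_empty [T2Space X] [T2Space S] {h : X × S ≃ₜ X × S} {Y : Set X}
    {I : TwoSidedIdeal (orbitBreaking h Y)} (hI : IsClosed (I : Set (orbitBreaking h Y)))
    (hz : zeroSet I = ∅) : I = ⊤ := by
  have hcl : IsClosed (funIdeal I : Set C(X × S, ℂ)) :=
    hI.preimage (AddMonoidHomClass.continuous_of_bound (funHom h Y) 1 fun f => by
      rw [one_mul]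
      exact NonUnitalStarAlgHom.norm_apply_le (funHom h Y) f)
  have hset : ContinuousMap.setOfIdeal (funIdeal I) = Set.univ := by
    rw [ContinuousMap.setOfIdeal, Set.compl_univ_iff]
    exact hz
  have h1 := ContinuousMap.idealOfSet_ofIdeal_eq_closure (𝕜 := ℂ) (funIdeal I)
  have h2 : (1 : C(X × S, ℂ)) ∈ ContinuousMap.idealOfSet ℂ
      (ContinuousMap.setOfIdeal (funIdeal I)) := by
    rw [hset]
    simp [ContinuousMap.mem_idealOfSet]
  rw [h1, ← SetLike.mem_coe, Ideal.coe_closure, hcl.closure_eq, SetLike.mem_coe, mem_funIdeal,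
    map_one] at h2
  exact (TwoSidedIdeal.one_mem_iff I).1 h2

/-- A continuous function vanishing on the fibre over `y` but not at a given other point. -/
theorem exists_vanishing_on_fibre [T2Space X] {y : X} {z : X × S} (hz : z.1 ≠ y) :
    ∃ g : C(X × S, ℂ), (∀ p : X × S, p.1 ∈ ({y} : Set X) → g p = 0) ∧ g z ≠ 0 := by
  obtain ⟨f, hf0, hf1, -⟩ := exists_continuous_zero_one_of_isClosed (isClosed_singleton (x := y))
    (isClosed_singleton (x := z.1)) (by simpa using hz.symm)
  refine ⟨⟨fun p => (f p.1 : ℂ), by fun_prop⟩, ?_, ?_⟩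
  · intro p hp
    simpa using hf0 hp
  · have := hf1 (Set.mem_singleton z.1)
    simp [this]

theorem apply_mem_zeroSet [T2Space X] {h : X × S ≃ₜ X × S} {y : X}
    {I : TwoSidedIdeal (orbitBreaking h {y})} {z : X × S} (hz : z ∈ zeroSet I) (hzy : z.1 ≠ y) :
    h z ∈ zeroSet I := by
  intro f hf
  obtain ⟨g, hg, hgz⟩ := exists_vanishing_on_fibre hzy
  have h1 : funHom h {y} (star g * f.comp (h : C(X × S, X × S)) * g) ∈ I := by
    rw [← star_shiftElem_conj h {y} f g hg]
    exact I.mul_mem_right _ _ (I.mul_mem_left _ _ hf)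
  simpa [hgz] using hz _ h1

theorem symm_apply_mem_zeroSet [T2Space X] {h : X × S ≃ₜ X × S} {y : X}
    {I : TwoSidedIdeal (orbitBreaking h {y})} {z : X × S} (hz : z ∈ zeroSet I)
    (hzy : (h.symm z).1 ≠ y) : h.symm z ∈ zeroSet I := by
  intro f hf
  obtain ⟨g, hg, hgz⟩ := exists_vanishing_on_fibre hzy
  have h1 : funHom h {y} ((g * f * star g).comp (h.symm : C(X × S, X × S))) ∈ I := by
    rw [← shiftElem_conj h {y} f g hg]
    exact I.mul_mem_right _ _ (I.mul_mem_left _ _ hf)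
  simpa [hgz] using hz _ h1

/-- If no orbit meets the fibre over `y` twice, the zero set of an ideal is trivial. -/
theorem zeroSet_eq_empty_or_univ [T2Space X] {h : X × S ≃ₜ X × S} (hm : IsMinimalHomeo h) {y : X}
    (hfree : ∀ (k : ℤ) (z : X × S), k ≠ 0 → z.1 = y → ((h ^ k) z).1 ≠ y)
    (I : TwoSidedIdeal (orbitBreaking h {y})) : zeroSet I = ∅ ∨ zeroSet I = Set.univ := by
  rcases Set.eq_empty_or_nonempty (zeroSet I) with h0 | ⟨z, hz⟩
  · exact Or.inl h0
  right
  have hone : ∀ {g : X × S ≃ₜ X × S}, IsMinimalHomeo g → ∀ w : X × S,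
      (∀ n : ℕ, (g ^ n) w ∈ zeroSet I) → zeroSet I = Set.univ := by
    intro g hg w hw
    have huniv := hg.eq_univ_of_forward (G := ⋂ n : ℕ, (g ^ n) ⁻¹' zeroSet I)
      (isClosed_iInter fun n => (isClosed_zeroSet I).preimage (g ^ n).continuous)
      ⟨w, Set.mem_iInter.2 hw⟩ (fun z hz => Set.mem_iInter.2 fun n => by
        have := Set.mem_iInter.1 hz (n + 1)
        rwa [pow_succ] at this)
    refine Set.eq_univ_of_forall fun z => ?_
    have : z ∈ ⋂ n : ℕ, (g ^ n) ⁻¹' zeroSet I := huniv ▸ Set.mem_univ z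
    simpa using Set.mem_iInter.1 this 0
  by_cases hy : ∀ n : ℕ, ((h ^ n) z).1 ≠ y
  · refine hone hm z fun n => ?_
    induction n with
    | zero => simpa using hz
    | succ n ih =>
      rw [pow_succ']
      exact apply_mem_zeroSet ih (hy n)
  · push Not at hy
    obtain ⟨m, hm'⟩ := hy
    refine hone hm.symm z fun n => ?_
    induction n with
    | zero => simpa using hz
    | succ n ih =>
      rw [pow_succ']
      refine symm_apply_mem_zeroSet ih ?_
      have h1 := hfree (-(n + 1 + m : ℕ)) _ (by omega) hm'
      have h2 : (h ^ (-(n + 1 + m : ℕ) : ℤ)) ((h ^ m) z) = h.symm ((h.symm ^ n) z) := by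
        change _ = (h⁻¹) ((h⁻¹ ^ n) z)
        rw [← Homeomorph.mul_apply, ← Homeomorph.mul_apply]
        congr 1
        rw [← zpow_natCast, ← zpow_natCast, inv_zpow', ← zpow_add, ← zpow_neg_one, ← zpow_add]
        congr 1
        push_cast
        ring
      rwa [h2] at h1

theorem isSimpleCStar_orbitBreaking [T2Space X] [T2Space S] [Nonempty S] {h : X × S ≃ₜ X × S}
    (hm : IsMinimalHomeo h) (hcol : HasColorings h) {y : X}
    (hfree : ∀ (k : ℤ) (z : X × S), k ≠ 0 → z.1 = y → ((h ^ k) z).1 ≠ y) :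
    IsSimpleCStar (orbitBreaking h {y}) := by
  have : Nonempty X := ⟨y⟩
  refine ⟨?_, fun I hI => ?_⟩
  · have := nontrivial_pairProduct h
    exact (inclHom h {y}).toAlgHom.toRingHom.domain_nontrivial
  rcases zeroSet_eq_empty_or_univ hm hfree I with hz | hz
  · exact Or.inr (eq_top_of_zeroSet_eq_empty hI hz)
  left
  rw [eq_bot_iff]
  intro a ha
  rw [TwoSidedIdeal.mem_bot]
  have hsmul : ∀ (c : ℂ) (b : orbitBreaking h {y}), b ∈ I → c • b ∈ I := by
    intro c b hb
    rw [← one_mul b, ← smul_mul_assoc]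
    exact I.mul_mem_left _ _ hb
  let J : Submodule ℂ (PairProduct h) :=
    { carrier := inclHom h {y} '' I
      zero_mem' := ⟨0, I.zero_mem, map_zero _⟩
      add_mem' := by
        rintro _ _ ⟨b, hb, rfl⟩ ⟨c, hc, rfl⟩
        exact ⟨b + c, I.add_mem hb hc, map_add _ _ _⟩
      smul_mem' := by
        rintro c _ ⟨b, hb, rfl⟩
        exact ⟨c • b, hsmul c b hb, map_smul _ _ _⟩ }
  have hJ : IsClosed (J : Set (PairProduct h)) :=
    (NonUnitalStarAlgHom.isometry (inclHom h {y})
      (inclHom_injective h {y})).isClosedEmbedding.isClosedMap _ hI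
  refine inclHom_injective h {y} ?_
  rw [map_zero]
  refine eq_zero_of_forall_pairHom_mem hcol J hJ ?_ ?_ (a := inclHom h {y} a) a.1.2 ?_
  · rintro f g _ ⟨b, hb, rfl⟩
    refine ⟨funHom h {y} f * (b * funHom h {y} g),
      I.mul_mem_left _ _ (I.mul_mem_right _ _ hb), ?_⟩
    rw [map_mul, map_mul]
    rfl
  · rintro f ⟨b, hb, hbf⟩
    have : b = funHom h {y} f := inclHom_injective h {y} hbf
    subst this
    ext z
    have hzz : z ∈ zeroSet I := hz ▸ Set.mem_univ z
    exact hzz f hb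
  · refine ⟨star a * a, I.mul_mem_left _ _ ha, ?_⟩
    rw [map_mul, map_star]

end FibreBreaking

end OrbitBreaking

end

theorem proposition2p2 {X : Type u} [TopologicalSpace X] [CompactSpace X]
    [TopologicalSpace.MetrizableSpace X] [TotallyDisconnectedSpace X] [PerfectSpace X]
    (n : ℕ) (hn : Odd n) (hn3 : 3 ≤ n)
    (α : X ≃ₜ X)
    (β : Metric.sphere (0 : EuclideanSpace ℝ (Fin (n + 1))) 1 ≃ₜ
      Metric.sphere (0 : EuclideanSpace ℝ (Fin (n + 1))) 1)
    (hmin : OrbitBreaking.IsMinimalHomeo (α.prodCongr β))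
    (y : X) :
    OrbitBreaking.IsSimpleCStar (OrbitBreaking.orbitBreaking (α.prodCongr β) {y}) := by
  have : Nonempty (Metric.sphere (0 : EuclideanSpace ℝ (Fin (n + 1))) 1) :=
    (NormedSpace.sphere_nonempty.2 zero_le_one).to_subtype
  have hfree := fun (k : ℤ) (hk : k ≠ 0) (x : X) => hmin.zpow_apply_ne hk x
  refine OrbitBreaking.isSimpleCStar_orbitBreaking hmin (fun N => ?_) ?_
  · obtain ⟨M, hM, v, hv, hv'⟩ := OrbitBreaking.exists_coloring hfree N
    refine ⟨M, hM, v.comp ⟨Prod.fst, continuous_fst⟩, ?_, ?_⟩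
    · ext z
      simpa using DFunLike.congr_fun hv z.1
    · intro k hk hkN z
      rw [OrbitBreaking.prodCongr_zpow]
      exact hv' k hk hkN z.1
  · intro k z hk hz
    rw [OrbitBreaking.prodCongr_zpow, ← hz]
    exact hfree k hk z.1
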